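/- Let $A$ be the algebra $\mathbb{O}$ of octonions or the algebra $\mathbb{H}$ of quaternions, with its standard basis $e_0=1,e_1,\dots,e_{n-1}$ ($n=8$ or $n=4$) and coordinates $o=\sum_\alpha o_\alpha e_\alpha$. Consider the two differential equations on $A$ $$\frac{do}{dt}=b^{-}(t)+b^{0_L}(t)\,o+o\,b^{0_R}(t)+e(t)\,o^2 ,\qquad\qquad \frac{do}{dt}=b^{-}(t)+b^{0_L}(t)\,o+o\,b^{0_R}(t)+o^2 e(t),$$ with continuous coefficients $b^{-},b^{0_L},b^{0_R},e:\mathbb{R}\to A$. Write $X_t$ for the vector field on $A$ given by the right-hand side at time $t$. Call the coefficients generic if the vector fields $X_t$, $t\in\mathbb{R}$, span over $\mathbb{R}$ all the vector fields $o\mapsto a+bo+oc+d\,o^2$ (respectively $o\mapsto a+bo+oc+o^2d$), $a,b,c,d\in A$. The minimal Lie algebra $V^X$ is the smallest real Lie algebra of smooth vector fields on $A$ containing all the $X_t$. A superposition rule depending on $m\ge 0$ particular solutions for a system $do/dt=X_t(o)$ is a smooth map $\Phi:W\to A$, with $W\subseteq A^m\times A$ open, independent of $t$, such that * for all solutions $x_1,\dots,x_m$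 on an open interval $I$ and all $\lambda\in A$ with $(x_1(t),\dots,x_m(t),\lambda)\in W$ for all $t\in I$, the curve $t\mapsto\Phi(x_1(t),\dots,x_m(t),\lambda)$ is a solution on $I$; * there is a nonempty open set $G\subseteq A^m\times A$ such that, for all solutions $x_1,\dots,x_m,y$ on an open interval $I$ with $(x_1(t),\dots,x_m(t),y(t))\in G$ for all $t\in I$, there is $\lambda\in A$ with $(x_1(t),\dots,x_m(t),\lambda)\in W$ and $y(t)=\Phi(x_1(t),\dots,x_m(t),\lambda)$ for all $t\in I$. (So even a rule that works only locally counts as a superposition rule.) A system that admits a superposition rule, for some $m$, is a Lie system. **Proposition.** For each of the two equations, over $\mathbb{O}$ as well as over $\mathbb{H}$, generic continuous coefficients exist, and for all generic continuous coefficients: 1. the equation is not a Lie system, i.e. it admits no superposition rule; 2. $V^X$ contains the polynomial vector fields $o_\beta^{\,k}\,\partial/\partial o_\alpha$ for all $\alpha\neq\beta$ in $\{0,\dots,n-1\}$ and all $k\ge 0$, hence polynomial vector fields of arbitrarily high degree; 3. $V^X$ is infinite-dimensional. -/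

import Mathlib

open scoped ContDiff Quaternion

noncomputable section

/-! ### Quaternions and octonions -/

/-- The standard basis `1, i, j, k` of the quaternions. -/
def quaternionUnit (α : Fin 4) : ℍ[ℝ] :=
  ⟨if α = 0 then 1 else 0, if α = 1 then 1 else 0, if α = 2 then 1 else 0, if α = 3 then 1 else 0⟩

/-- The coordinates of a quaternion in the standard basis. -/
def quaternionCoord (β : Fin 4) (q : ℍ[ℝ]) : ℝ := ![q.re, q.imI, q.imJ, q.imK] β

/-- The octonions as pairs of quaternions, with the Euclidean norm of `ℝ⁸`. The multiplication is
the instance below. -/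
abbrev Octonion : Type := WithLp 2 (ℍ[ℝ] × ℍ[ℝ])

namespace Octonion

/-- The octonion `a + b ℓ`, where `a`, `b` are quaternions. -/
def mk (a b : ℍ[ℝ]) : Octonion := WithLp.toLp 2 (a, b)

/-- The Cayley-Dickson product `(a, b) (c, d) = (a c - d̄ b, d a + b c̄)`. -/
instance : Mul Octonion where
  mul x y := mk (x.fst * y.fst - star y.snd * x.snd) (y.snd * x.fst + x.snd * star y.fst)

/-- The standard basis `e₀ = 1, e₁ = i, e₂ = j, e₃ = k, e₄ = ℓ, e₅ = i ℓ, e₆ = j ℓ, e₇ = k ℓ`.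
In it `e₁ e₂ = e₃`, `e₁ e₄ = e₅`, `e₂ e₄ = e₆`, `e₃ e₄ = e₇`, `e₁ e₇ = e₆`, `e₂ e₅ = e₇`,
`e₃ e₆ = e₅`. -/
def unit (α : Fin 8) : Octonion :=
  ![mk (quaternionUnit 0) 0, mk (quaternionUnit 1) 0, mk (quaternionUnit 2) 0,
    mk (quaternionUnit 3) 0, mk 0 (quaternionUnit 0), mk 0 (quaternionUnit 1),
    mk 0 (quaternionUnit 2), mk 0 (quaternionUnit 3)] α

/-- The coordinates `o₀, …, o₇` of an octonion in the standard basis. -/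
def coord (β : Fin 8) (o : Octonion) : ℝ :=
  ![o.fst.re, o.fst.imI, o.fst.imJ, o.fst.imK, o.snd.re, o.snd.imI, o.snd.imJ, o.snd.imK] β

end Octonion

/-! ### Lie systems -/

section LieSystems

variable {E : Type*} [NormedAddCommGroup E] [NormedSpace ℝ E]

/-- `V` is a real Lie algebra of (smooth) vector fields on `E`. -/
structure IsLieAlgebraOfFields (V : Submodule ℝ (E → E)) : Prop where
  smooth : ∀ Y ∈ V, ContDiff ℝ ∞ Y
  bracket_mem : ∀ Y ∈ V, ∀ Z ∈ V, VectorField.lieBracket ℝ Y Z ∈ V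

/-- The minimal Lie algebra of a `t`-dependent vector field `X` (with every `X t` smooth):
the smallest real Lie algebra of vector fields that contains all the `X t`. -/
def minimalLieAlgebra (X : ℝ → E → E) : Submodule ℝ (E → E) :=
  sInf {V | IsLieAlgebraOfFields V ∧ ∀ t, X t ∈ V}

/-- `Φ`, defined and smooth on the open set `W ⊆ Eᵐ × E`, is a superposition rule depending on
`m` particular solutions for the system `dx/dt = X(t, x)`.

Solutions are taken on open intervals `I`, since they need not exist for all times, and `Φ` need
not be defined everywhere. "Generic" is read in the weakest way, as "in some nonempty open set":
a rule that works on an open dense set of data, or everywhere, is one in this sense too. -/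
structure IsSuperpositionRule (X : ℝ → E → E) (m : ℕ) (Φ : (Fin m → E) × E → E)
    (W : Set ((Fin m → E) × E)) : Prop where
  isOpen_domain : IsOpen W
  smooth : ContDiffOn ℝ ∞ Φ W
  /-- Each `Φ(x₁(t), …, xₘ(t); p)` is a solution. -/
  solution : ∀ I : Set ℝ, IsOpen I → I.OrdConnected →
    ∀ x : Fin m → ℝ → E, (∀ i, IsIntegralCurveOn (x i) X I) →
    ∀ p : E, (∀ t ∈ I, ((fun i => x i t), p) ∈ W) →
      IsIntegralCurveOn (fun t => Φ ((fun i => x i t), p)) X I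
  /-- The generic solution is `Φ(x₁(t), …, xₘ(t); p)` for some constant `p`, when
  `x₁, …, xₘ` are generic solutions. -/
  general : ∃ G : Set ((Fin m → E) × E), IsOpen G ∧ G.Nonempty ∧
    ∀ I : Set ℝ, IsOpen I → I.OrdConnected →
    ∀ (x : Fin m → ℝ → E) (y : ℝ → E), (∀ i, IsIntegralCurveOn (x i) X I) →
      IsIntegralCurveOn y X I → (∀ t ∈ I, ((fun i => x i t), y t) ∈ G) →
      ∃ p : E, ∀ t ∈ I, ((fun i => x i t), p) ∈ W ∧ y t = Φ ((fun i => x i t), p)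

/-- A Lie system: a system that admits a superposition rule. -/
def IsLieSystem (X : ℝ → E → E) : Prop :=
  ∃ (m : ℕ) (Φ : (Fin m → E) × E → E) (W : Set ((Fin m → E) × E)), IsSuperpositionRule X m Φ W

end LieSystems

/-! ### The equations -/

/-- The vector field `o ↦ b⁻ + b^L o + o b^R + e o²`. -/
def leftQuadraticField {A : Type*} [Add A] [Mul A] (bm bL bR e : A) (o : A) : A :=
  bm + bL * o + o * bR + e * (o * o)

/-- The vector field `o ↦ b⁻ + b^L o + o b^R + o² f`. -/
def rightQuadraticField {A : Type*} [Add A] [Mul A] (bm bL bR f : A) (o : A) : A :=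
  bm + bL * o + o * bR + (o * o) * f

/-- The coefficient functions are generic for the family `F` of vector fields: the vector fields
`X t = F (bm t) (bL t) (bR t) (e t)` span, over `ℝ`, all the vector fields of the family. -/
def IsGenericCoefficients {A : Type*} [AddCommGroup A] [Module ℝ A] (F : A → A → A → A → A → A)
    (bm bL bR e : ℝ → A) : Prop :=
  ∀ a b c d : A,
    F a b c d ∈ Submodule.span ℝ (Set.range fun t => F (bm t) (bL t) (bR t) (e t))

end

/-! A superposition rule `Φ` intertwines the prolongation of each `X t` (the field acting on every
particular solution and fixing the constant) with `X t` itself. Such relations pass to linear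
combinations and brackets, so they hold on all of `minimalLieAlgebra X`. If that algebra contains
every p(c(x)) v, for some nonzero linear form c and vector v, take p to vanish at all c(x_i): the
prolongation vanishes at (x, λ), so p(c(y)) v = 0 at y = Φ(x, λ). But y may be chosen with c(y)
different from every c(x_i), a contradiction (`not_isLieSystem_of_polynomial_mem`). Infinite
dimension follows from the same polynomials.

The polynomial fields come from brackets of constant fields with o² and its products by units
(`monomialField_mem`). Only o² = 2 Re(o) o - |o|² and the products of each unit with 1 and with
itself enter, so associativity is not needed and left and right coefficients are treated alike. -/

/-! ### Superposition rules and prolonged vector fields. -/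

section LieSystemObstruction

open Topology Metric Polynomial

variable {E : Type*} [NormedAddCommGroup E] [NormedSpace ℝ E]

/-- Local existence of solutions of `dx/dt = G(γ(t), x)`, for `G` of class `C¹` and `γ` continuous. -/
theorem exists_isIntegralCurveAt_comp [CompleteSpace E] {M : Type*} [NormedAddCommGroup M]
    [NormedSpace ℝ M] {G : M × E → E} (hG : ContDiff ℝ 1 G) {γ : ℝ → M} (hγ : Continuous γ)
    (t₀ : ℝ) (x₀ : E) :
    ∃ α : ℝ → E, α t₀ = x₀ ∧ IsIntegralCurveAt α (fun t x => G (γ t, x)) t₀ := by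
  obtain ⟨K, s, hs, hK⟩ := (hG.contDiffAt (x := (γ t₀, x₀))).exists_lipschitzOnWith
  have hb : {z | ‖G z‖ < ‖G (γ t₀, x₀)‖ + 1} ∈ 𝓝 (γ t₀, x₀) :=
    (hG.continuous.norm.continuousAt).eventually_lt continuousAt_const (lt_add_one _)
  obtain ⟨u, hu, v, hv, huv⟩ := mem_nhds_prod_iff.mp (Filter.inter_mem hs hb)
  obtain ⟨a, ha, hav⟩ := nhds_basis_closedBall.mem_iff.mp hv
  obtain ⟨δ, hδ, hδu⟩ := nhds_basis_closedBall.mem_iff.mp (hγ.continuousAt.preimage_mem_nhds hu)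
  set L : NNReal := ⟨‖G (γ t₀, x₀)‖ + 1, by positivity⟩ with hL
  have hLpos : (0 : ℝ) < L := by
    rw [hL]
    change 0 < ‖G (γ t₀, x₀)‖ + 1
    positivity
  -- Up to time δ the curve `γ` stays where the bounds hold; up to time a / L a curve of speed at
  -- most `L` stays in the ball of radius `a`.
  set ε := min δ (a / L) with hε
  have hεpos : 0 < ε := lt_min hδ (by positivity)
  have hmem : ∀ t ∈ Set.Icc (t₀ - ε) (t₀ + ε), ∀ x ∈ closedBall x₀ a,
      (γ t, x) ∈ s ∩ {z | ‖G z‖ < ‖G (γ t₀, x₀)‖ + 1} := by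
    intro t ht x hx
    refine huv ⟨hδu ?_, hav hx⟩
    rw [Real.closedBall_eq_Icc]
    have := min_le_left δ (a / L)
    exact ⟨by linarith [ht.1], by linarith [ht.2]⟩
  have hPL : IsPicardLindelof (fun t x => G (γ t, x)) (tmin := t₀ - ε) (tmax := t₀ + ε)
      ⟨t₀, by constructor <;> linarith⟩ x₀ ⟨a, ha.le⟩ 0 L K :=
    { lipschitzOnWith := by
        intro t ht
        have h := hK.comp ((LipschitzWith.prodMk_left (γ t)).lipschitzOnWith
          (s := closedBall x₀ a)) (fun x hx => (hmem t ht x hx).1)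
        simpa using! h
      continuousOn := fun x _ => (hG.continuous.comp (by fun_prop)).continuousOn
      norm_le := fun t ht x hx => (hmem t ht x hx).2.le
      mul_max_le := by
        have h : ε ≤ a / L := min_le_right _ _
        rw [le_div_iff₀ hLpos] at h
        simp only [add_sub_cancel_left, sub_sub_cancel, max_self, NNReal.coe_zero, sub_zero]
        change L * ε ≤ a
        linarith }
  obtain ⟨α, hα, hα'⟩ := hPL.exists_eq_forall_mem_Icc_hasDerivWithinAt₀
  refine ⟨α, hα, ?_⟩
  filter_upwards [Ioo_mem_nhds (sub_lt_self t₀ hεpos) (lt_add_of_pos_right t₀ hεpos)] with t ht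
  exact (hα' t (Set.Ioo_subset_Icc_self ht)).hasDerivAt (Icc_mem_nhds ht.1 ht.2)

/-- Brackets of fields related by a map are related by it. -/
theorem fderiv_lieBracket_of_related {M : Type*} [NormedAddCommGroup M] [NormedSpace ℝ M]
    {Φ : M → E} {W : Set M} (hW : IsOpen W) (hΦ : ContDiffOn ℝ ∞ Φ W) {Y' Z' : M → M} {Y Z : E → E}
    (hY' : Differentiable ℝ Y') (hZ' : Differentiable ℝ Z')
    (hY : Differentiable ℝ Y) (hZ : Differentiable ℝ Z)
    (hYY : ∀ z ∈ W, fderiv ℝ Φ z (Y' z) = Y (Φ z)) (hZZ : ∀ z ∈ W, fderiv ℝ Φ z (Z' z) = Z (Φ z))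
    {z : M} (hz : z ∈ W) :
    fderiv ℝ Φ z (VectorField.lieBracket ℝ Y' Z' z) = VectorField.lieBracket ℝ Y Z (Φ z) := by
  have hΦz : ContDiffAt ℝ ∞ Φ z := hΦ.contDiffAt (hW.mem_nhds hz)
  have hd : DifferentiableAt ℝ Φ z := hΦz.differentiableAt (by simp)
  have hdd : DifferentiableAt ℝ (fderiv ℝ Φ) z :=
    (hΦz.fderiv_right (m := 1) (by norm_cast)).differentiableAt (by simp)
  have hsymm : IsSymmSndFDerivAt ℝ Φ z := hΦz.isSymmSndFDerivAt
    (by rw [minSmoothness_of_isRCLikeNormedField]; exact WithTop.coe_le_coe.mpr le_top)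
  -- Differentiate DΦ(V') = V ∘ Φ in the direction `w`. Using this for `Z` along `Y'` and for `Y`
  -- along `Z'` and subtracting, the second derivatives of `Φ` cancel by symmetry.
  have key : ∀ {V' : M → M} {V : E → E}, Differentiable ℝ V' → Differentiable ℝ V →
      (∀ z ∈ W, fderiv ℝ Φ z (V' z) = V (Φ z)) → ∀ w,
      fderiv ℝ (fderiv ℝ Φ) z w (V' z) + fderiv ℝ Φ z (fderiv ℝ V' z w) =
        fderiv ℝ V (Φ z) (fderiv ℝ Φ z w) := by
    intro V' V hV' hV h w
    have h1 := (hdd.hasFDerivAt.clm_apply (hV' z).hasFDerivAt)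
    have h2 := (hV (Φ z)).hasFDerivAt.comp z hd.hasFDerivAt
    have h3 : (fun y => fderiv ℝ Φ y (V' y)) =ᶠ[𝓝 z] V ∘ Φ := by
      filter_upwards [hW.mem_nhds hz] with y hy using h y hy
    have h4 := DFunLike.congr_fun ((h2.congr_of_eventuallyEq h3).unique h1) w
    simp only [ContinuousLinearMap.comp_apply, add_apply,
      ContinuousLinearMap.flip_apply] at h4
    rw [h4, add_comm]
  have e1 := key hZ' hZ hZZ (Y' z)
  have e2 := key hY' hY hYY (Z' z)
  rw [hYY z hz] at e1
  rw [hZZ z hz] at e2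
  simp only [VectorField.lieBracket_eq, map_sub]
  rw [← e1, ← e2, hsymm.eq (Y' z) (Z' z)]
  abel

/-- The prolongation of a vector field to `m` particular solutions and a constant. -/
noncomputable def prolongation (m : ℕ) (Y : E → E) (z : (Fin m → E) × E) : (Fin m → E) × E :=
  (fun i => Y (z.1 i), 0)

theorem hasFDerivAt_prolongation {m : ℕ} {Y : E → E} (hY : Differentiable ℝ Y)
    (z : (Fin m → E) × E) :
    HasFDerivAt (prolongation m Y)
      ((ContinuousLinearMap.pi fun i => (fderiv ℝ Y (z.1 i)).comp
        ((ContinuousLinearMap.proj i).comp (ContinuousLinearMap.fst ℝ (Fin m → E) E))).prod 0) z := by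
  refine HasFDerivAt.prodMk (hasFDerivAt_pi.mpr fun i => ?_) (hasFDerivAt_const _ _)
  exact (hY (z.1 i)).hasFDerivAt.comp z
    ((ContinuousLinearMap.proj (R := ℝ) (φ := fun _ : Fin m => E) i).comp
      (ContinuousLinearMap.fst ℝ (Fin m → E) E)).hasFDerivAt

/-- The copies of `E` do not interact and the last component is zero, so the bracket is computed
copy by copy. -/
theorem lieBracket_prolongation {m : ℕ} {Y Z : E → E} (hY : Differentiable ℝ Y)
    (hZ : Differentiable ℝ Z) :
    VectorField.lieBracket ℝ (prolongation m Y) (prolongation m Z) =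
      prolongation m (VectorField.lieBracket ℝ Y Z) := by
  ext1 z
  rw [VectorField.lieBracket, (hasFDerivAt_prolongation hY z).fderiv,
    (hasFDerivAt_prolongation hZ z).fderiv]
  refine Prod.ext ?_ ?_
  · ext i
    simp [prolongation, VectorField.lieBracket_eq]
  · simp [prolongation]

variable {X : ℝ → E → E} {m : ℕ} {Φ : (Fin m → E) × E → E} {W : Set ((Fin m → E) × E)}

/-- Through every family of initial data there are solutions on a common interval, on which an open
condition persists. -/
theorem exists_isIntegralCurveOn_of_mem
    (hex : ∀ t₀ x₀, ∃ α : ℝ → E, α t₀ = x₀ ∧ IsIntegralCurveAt α X t₀)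
    {ι F : Type*} [Finite ι] [TopologicalSpace F] {g : (ι → E) → F} (hg : Continuous g)
    {U : Set F} (hU : IsOpen U) (t : ℝ) {x : ι → E} (hx : g x ∈ U) :
    ∃ (ε : ℝ) (α : ι → ℝ → E), 0 < ε ∧ (∀ i, α i t = x i) ∧
      (∀ i, IsIntegralCurveOn (α i) X (ball t ε)) ∧ ∀ s ∈ ball t ε, g (fun i => α i s) ∈ U := by
  choose α hα hα' using fun i => hex t (x i)
  have hc : ContinuousAt (fun s => g fun i => α i s) t :=
    hg.continuousAt.comp (continuousAt_pi.mpr fun i => (hα' i).continuousAt)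
  have hev : ∀ᶠ s in 𝓝 t, (∀ i, HasDerivAt (α i) (X s (α i s)) s) ∧ g (fun i => α i s) ∈ U :=
    (Filter.eventually_all.mpr hα').and (hc.eventually_mem (hU.mem_nhds (by simpa [hα] using! hx)))
  obtain ⟨ε, hε, h⟩ := Metric.eventually_nhds_iff_ball.mp hev
  exact ⟨ε, α, hε, hα, fun i s hs => ((h s hs).1 i).hasDerivWithinAt, fun s hs => (h s hs).2⟩

/-- A superposition rule relates the prolongation of each `X t` to `X t`. -/
theorem IsSuperpositionRule.fderiv_prolongation (hΦ : IsSuperpositionRule X m Φ W)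
    (hex : ∀ t₀ x₀, ∃ α : ℝ → E, α t₀ = x₀ ∧ IsIntegralCurveAt α X t₀) (t : ℝ)
    {z : (Fin m → E) × E} (hz : z ∈ W) :
    fderiv ℝ Φ z (prolongation m (X t) z) = X t (Φ z) := by
  obtain ⟨ε, α, hε, hα, hsol, hW⟩ := exists_isIntegralCurveOn_of_mem hex
    (g := fun x : Fin m → E => (x, z.2)) (by fun_prop) hΦ.isOpen_domain t (x := z.1) hz
  have hI : ball t ε ∈ 𝓝 t := ball_mem_nhds t hε
  have h1 := (hΦ.solution (ball t ε) isOpen_ball (convex_ball t ε).ordConnected α hsol z.2 hW t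
    (mem_ball_self hε)).hasDerivAt hI
  have hzt : ((fun i => α i t), z.2) = z := Prod.ext (funext hα) rfl
  have h2 : HasDerivAt (fun s => ((fun i => α i s), z.2)) (prolongation m (X t) z) t := by
    refine HasDerivAt.prodMk (hasDerivAt_pi.mpr fun i => ?_) (hasDerivAt_const _ _)
    rw [← hα i]
    exact (hsol i t (mem_ball_self hε)).hasDerivAt hI
  have hd : HasFDerivAt Φ (fderiv ℝ Φ z) ((fun i => α i t), z.2) := by
    rw [hzt]
    exact ((hΦ.smooth.contDiffAt (hΦ.isOpen_domain.mem_nhds hz)).differentiableAt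
      (by simp)).hasFDerivAt
  -- Two values of one derivative, that of `Φ` along the solutions: the chain rule, and the fact
  -- that the image curve is a solution.
  have h3 := (hd.comp_hasDerivAt t h2).unique h1
  exact h3.trans (congrArg (fun w => X t (Φ w)) hzt)

/-- A superposition rule relates the prolongation of each field of the minimal Lie algebra to the
field itself. -/
theorem IsSuperpositionRule.fderiv_prolongation_of_mem (hΦ : IsSuperpositionRule X m Φ W)
    (hX : ∀ t, ContDiff ℝ ∞ (X t))
    (hex : ∀ t₀ x₀, ∃ α : ℝ → E, α t₀ = x₀ ∧ IsIntegralCurveAt α X t₀)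
    {Y : E → E} (hY : Y ∈ minimalLieAlgebra X) {z : (Fin m → E) × E} (hz : z ∈ W) :
    fderiv ℝ Φ z (prolongation m Y z) = Y (Φ z) := by
  let V : Submodule ℝ (E → E) :=
    { carrier := {Y | ContDiff ℝ ∞ Y ∧ ∀ z ∈ W, fderiv ℝ Φ z (prolongation m Y z) = Y (Φ z)}
      add_mem' := by
        rintro Y Z ⟨hY, hY'⟩ ⟨hZ, hZ'⟩
        refine ⟨hY.add hZ, fun z hz => ?_⟩
        have h : prolongation m (Y + Z) z = prolongation m Y z + prolongation m Z z :=
          Prod.ext rfl (add_zero 0).symm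
        rw [h, map_add, hY' z hz, hZ' z hz, Pi.add_apply]
      zero_mem' := by
        refine ⟨contDiff_const, fun z _ => ?_⟩
        have h : prolongation m (0 : E → E) z = 0 := rfl
        rw [h, map_zero, Pi.zero_apply]
      smul_mem' := by
        rintro r Y ⟨hY, hY'⟩
        refine ⟨contDiff_const.smul hY, fun z hz => ?_⟩
        have h : prolongation m (r • Y) z = r • prolongation m Y z :=
          Prod.ext rfl (smul_zero r).symm
        rw [h, map_smul, hY' z hz, Pi.smul_apply] }
  have hV : IsLieAlgebraOfFields V :=
    { smooth := fun Y hY => hY.1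
      bracket_mem := by
        rintro Y ⟨hY, hY'⟩ Z ⟨hZ, hZ'⟩
        have hYd := hY.differentiable (by simp)
        have hZd := hZ.differentiable (by simp)
        refine ⟨?_, fun z hz => ?_⟩
        · exact hY.lieBracket_vectorField hZ (by simp)
        · rw [← lieBracket_prolongation hYd hZd]
          exact fderiv_lieBracket_of_related hΦ.isOpen_domain hΦ.smooth
            (fun z => (hasFDerivAt_prolongation hYd z).differentiableAt)
            (fun z => (hasFDerivAt_prolongation hZd z).differentiableAt) hYd hZd hY' hZ' hz }
  have hle : minimalLieAlgebra X ≤ V :=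
    sInf_le ⟨hV, fun t => ⟨hX t, fun z hz => hΦ.fderiv_prolongation hex t hz⟩⟩
  exact (hle hY).2 z hz

/-- A system is not a Lie system if its minimal Lie algebra contains all polynomials in some
coordinate times some fixed vector. -/
theorem not_isLieSystem_of_polynomial_mem (hX : ∀ t, ContDiff ℝ ∞ (X t))
    (hex : ∀ t₀ x₀, ∃ α : ℝ → E, α t₀ = x₀ ∧ IsIntegralCurveAt α X t₀)
    {c : E →ₗ[ℝ] ℝ} (hc : c ≠ 0) {v : E} (hv : v ≠ 0)
    (hp : ∀ p : ℝ[X], (fun x => p.eval (c x) • v) ∈ minimalLieAlgebra X) :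
    ¬ IsLieSystem X := by
  rintro ⟨m, Φ, W, hΦ⟩
  obtain ⟨G, hG, ⟨⟨x, y₀⟩, hxy₀⟩, hgen⟩ := hΦ.general
  obtain ⟨w, hw⟩ : ∃ w, c w ≠ 0 := by
    by_contra! h
    exact hc (LinearMap.ext h)
  have hnhds : {s : ℝ | (x, y₀ + s • w) ∈ G} ∈ 𝓝 (0 : ℝ) := by
    refine (hG.preimage (by fun_prop : Continuous fun s : ℝ => (x, y₀ + s • w))).mem_nhds ?_
    simpa using hxy₀
  -- The excluded `s` are those for which y₀ + s w has the same `c`-value as some `x i`.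
  obtain ⟨s, hs, hsx⟩ := (infinite_of_mem_nhds (0 : ℝ) hnhds).exists_notMem_finite
    (Set.finite_range fun i => (c (x i) - c y₀) / c w)
  set y := y₀ + s • w with hy
  have hyx : ∀ i, c y ≠ c (x i) := by
    intro i h
    refine hsx ⟨i, ?_⟩
    simp [← h, hy, hw]
  -- The index `none` carries the solution through `y`, the indices `some i` those through `x i`.
  obtain ⟨ε, α, hε, hα, hsol, hαG⟩ := exists_isIntegralCurveOn_of_mem hex
    (g := fun u : Option (Fin m) → E => ((fun i => u (some i)), u none)) (by fun_prop) hG 0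
    (x := fun o => o.elim y x) hs
  obtain ⟨p, hpW⟩ := hgen (ball 0 ε) isOpen_ball (convex_ball 0 ε).ordConnected
    (fun i => α (some i)) (α none) (fun i => hsol _) (hsol _) hαG
  obtain ⟨h1, h2⟩ := hpW 0 (mem_ball_self hε)
  have hx0 : (fun i => α (some i) 0) = x := funext fun i => hα (some i)
  rw [hx0] at h1 h2
  rw [show α none 0 = y from hα none] at h2
  -- This polynomial vanishes at every c(x_i) but not at c(y).
  have h3 := hΦ.fderiv_prolongation_of_mem hX hex (hp (∏ i, (Polynomial.X - C (c (x i))))) h1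
  have h4 : prolongation m (fun x' => (∏ i, (Polynomial.X - C (c (x i)))).eval (c x') • v) (x, p) = 0 := by
    refine Prod.ext (funext fun i => ?_) rfl
    simp only [prolongation, eval_prod]
    rw [Finset.prod_eq_zero (Finset.mem_univ i) (by simp), zero_smul]
    rfl
  rw [h4, map_zero, ← h2] at h3
  rcases smul_eq_zero.mp h3.symm with h | h
  · rw [eval_prod, Finset.prod_eq_zero_iff] at h
    obtain ⟨i, -, h⟩ := h
    exact hyx i (by simpa [sub_eq_zero] using h)
  · exact hv h

/-- A space of fields is infinite-dimensional if it contains all polynomials in some coordinate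
times some fixed vector. -/
theorem not_finiteDimensional_of_polynomial_mem {V : Submodule ℝ (E → E)}
    {c : E →ₗ[ℝ] ℝ} (hc : c ≠ 0) {v : E} (hv : v ≠ 0)
    (hp : ∀ p : ℝ[X], (fun x => p.eval (c x) • v) ∈ V) : ¬ FiniteDimensional ℝ V := by
  intro hfin
  let f : ℝ[X] →ₗ[ℝ] V :=
    { toFun := fun p => ⟨_, hp p⟩
      map_add' := fun p q => Subtype.ext (funext fun x => by simp [add_smul])
      map_smul' := fun r p => Subtype.ext (funext fun x => by simp [mul_smul]) }
  have hinj : Function.Injective f := by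
    rw [injective_iff_map_eq_zero]
    intro p hpz
    refine Polynomial.funext fun r => ?_
    obtain ⟨x, rfl⟩ := LinearMap.surjective hc r
    have h : p.eval (c x) • v = 0 := congrFun (congrArg Subtype.val hpz) x
    simpa [hv] using h
  exact Polynomial.not_finite (R := ℝ) (Module.Finite.of_injective f hinj)

end LieSystemObstruction

/-! ### Generating polynomial fields by brackets. -/

section PolynomialFields

open ContinuousLinearMap

variable {E : Type*} [NormedAddCommGroup E] [NormedSpace ℝ E]

theorem IsLieAlgebraOfFields.mem_of_hasFDerivAt {V : Submodule ℝ (E → E)}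
    (hV : IsLieAlgebraOfFields V) {Y Z B : E → E} (hY : Y ∈ V) (hZ : Z ∈ V) {Y' Z' : E → E →L[ℝ] E}
    (hY' : ∀ x, HasFDerivAt Y (Y' x) x) (hZ' : ∀ x, HasFDerivAt Z (Z' x) x)
    (h : ∀ x, Z' x (Y x) - Y' x (Z x) = B x) : B ∈ V := by
  have hB := hV.bracket_mem Y hY Z hZ
  have he : VectorField.lieBracket ℝ Y Z = B := by
    ext1 x
    rw [VectorField.lieBracket, (hY' x).fderiv, (hZ' x).fderiv, h]
  rwa [he] at hB

variable {ι : Type*} (c : ι → E →L[ℝ] ℝ) (u : ι → E)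

/-- The vector field `o_β ^ k ∂/∂o_α`. -/
noncomputable def monomialField (k : ℕ) (β α : ι) (x : E) : E := c β x ^ k • u α

/-- The vector field `o_β ^ k o_γ ∂/∂o_α`. -/
noncomputable def mixedMonomialField (k : ℕ) (β γ α : ι) (x : E) : E := (c β x ^ k * c γ x) • u α

theorem hasFDerivAt_monomialField (k : ℕ) (β α : ι) (x : E) :
    HasFDerivAt (monomialField c u k β α) ((k * c β x ^ (k - 1)) • (c β).smulRight (u α)) x := by
  have h := ((c β).hasFDerivAt (x := x)).pow k |>.smul_const (u α)
  refine h.congr_fderiv ?_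
  ext v
  simp [smul_smul, nsmul_eq_mul]

theorem hasFDerivAt_mixedMonomialField (k : ℕ) (β γ α : ι) (x : E) :
    HasFDerivAt (mixedMonomialField c u k β γ α)
      ((k * c β x ^ (k - 1) * c γ x) • (c β).smulRight (u α) +
        (c β x ^ k) • (c γ).smulRight (u α)) x := by
  have h := (((c β).hasFDerivAt (x := x)).pow k).mul ((c γ).hasFDerivAt (x := x))
    |>.smul_const (u α)
  refine h.congr_fderiv ?_
  ext v
  simp [smul_smul, nsmul_eq_mul, add_smul]
  module

variable {c u} {V : Submodule ℝ (E → E)}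

/-- If a Lie algebra of fields contains all `o_β ∂/∂o_α` and `o_β² ∂/∂o_α`, `α ≠ β`, and there are
at least three coordinates, then it contains all `o_β ^ k ∂/∂o_α`. -/
theorem monomialField_mem_of_one_of_two (hV : IsLieAlgebraOfFields V)
    (hself : ∀ i, c i (u i) = 1) (hne : ∀ i j, i ≠ j → c i (u j) = 0)
    (hthird : ∀ i j : ι, ∃ k, k ≠ i ∧ k ≠ j)
    (h0 : ∀ α β, monomialField c u 0 β α ∈ V)
    (h1 : ∀ α β, α ≠ β → monomialField c u 1 β α ∈ V)
    (h2 : ∀ α β, α ≠ β → monomialField c u 2 β α ∈ V) (k : ℕ) :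
    ∀ α β, α ≠ β → monomialField c u k β α ∈ V := by
  induction k with
  | zero => exact fun α β _ => h0 α β
  | succ k ih =>
    intro α β hαβ
    obtain ⟨γ, hγα, hγβ⟩ := hthird α β
    -- [x_β^k ∂_γ, x_γ² ∂_α] = 2 x_β^k x_γ ∂_α; the bracket of x_β ∂_γ with x_β^k x_γ ∂_α then
    -- raises the exponent of x_β to k + 1.
    have h3 : (2 : ℝ) • mixedMonomialField c u k β γ α ∈ V := by
      refine hV.mem_of_hasFDerivAt (ih γ β hγβ) (h2 α γ hγα.symm)
        (hasFDerivAt_monomialField c u _ _ _) (hasFDerivAt_monomialField c u _ _ _) fun x => ?_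
      simp [monomialField, mixedMonomialField, hself, hne _ _ hαβ.symm, smul_smul]
      congr 1
      ring
    have h4 : mixedMonomialField c u k β γ α ∈ V := by
      simpa using V.smul_mem (2⁻¹ : ℝ) h3
    refine hV.mem_of_hasFDerivAt (h1 γ β hγβ) h4
      (hasFDerivAt_monomialField c u _ _ _) (hasFDerivAt_mixedMonomialField c u _ _ _ _) fun x => ?_
    simp [monomialField, mixedMonomialField, hself, hne _ _ hαβ.symm, hne _ _ hγβ.symm, smul_smul]
    congr 1
    ring

/-- A Lie algebra of fields that contains the constant fields, the square `o²` and its products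
with the units contains all `o_β ^ k ∂/∂o_α`, `α ≠ β`. -/
theorem monomialField_mem [Fintype ι] (hV : IsLieAlgebraOfFields V) {o : ι}
    (hself : ∀ i, c i (u i) = 1) (hne : ∀ i j, i ≠ j → c i (u j) = 0)
    (hthird : ∀ i j : ι, ∃ k, k ≠ i ∧ k ≠ j) {Q : E → E}
    (hQ : ∀ x, Q x = (2 * c o x) • x - (∑ i, c i x ^ 2) • u o)
    (hconst : ∀ α, (fun _ => u α) ∈ V) (hQV : Q ∈ V) (T : ι → E →L[ℝ] E)
    (hTo : ∀ i, i ≠ o → T i (u o) = u i) (hT : ∀ i, i ≠ o → T i (u i) = -u o)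
    (hTV : ∀ i, i ≠ o → (fun x => T i (Q x)) ∈ V) (k : ℕ) {α β : ι} (hαβ : α ≠ β) :
    monomialField c u k β α ∈ V := by
  have hQ' : ∀ x, HasFDerivAt Q ((2 * c o x) • ContinuousLinearMap.id ℝ E +
      (2 : ℝ) • (c o).smulRight x - (∑ i, (2 * c i x) • c i).smulRight (u o)) x := by
    intro x
    have e1 : HasFDerivAt (fun x => (2 * c o x) • x) _ x :=
      (((c o).hasFDerivAt (x := x)).const_mul 2).smul (hasFDerivAt_id x)
    have e2 : HasFDerivAt (fun x => (∑ i, c i x ^ 2) • u o) _ x :=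
      (HasFDerivAt.fun_sum fun i (_ : i ∈ Finset.univ) =>
        ((c i).hasFDerivAt (x := x)).pow 2).smul_const (u o)
    rw [show Q = _ from funext hQ]
    refine (e1.sub e2).congr_fderiv ?_
    ext v
    simp [smul_smul, mul_assoc]
  have hsum : ∀ x j, ∑ i, 2 * c i x * c i (u j) = 2 * c j x := by
    intro x j
    rw [Finset.sum_eq_single j (fun i _ hij => by simp [hne i j hij]) (by simp), hself, mul_one]
  have hlin : ∀ (L : E →L[ℝ] E) x, HasFDerivAt L L x := fun L x => L.hasFDerivAt
  -- Write 0 for the index `o`. Half of [∂_i, Q] is the rotation x_0 ∂_i - x_i ∂_0.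
  have hJ : ∀ i, i ≠ o → ⇑((c o).smulRight (u i) - (c i).smulRight (u o)) ∈ V := by
    intro i hi
    have h := V.smul_mem (2⁻¹ : ℝ) (hV.mem_of_hasFDerivAt (B := (2 : ℝ) •
      ⇑((c o).smulRight (u i) - (c i).smulRight (u o))) (hconst i) hQV
      (fun x => hasFDerivAt_const _ x) hQ' fun x => by
        simp [hsum, hne o i hi.symm]
        module)
    simpa using h
  -- Multiplying by u_i turns that rotation into minus x_0 ∂_0 + x_i ∂_i.
  have hP : ∀ i, i ≠ o → ⇑((c o).smulRight (u o) + (c i).smulRight (u i)) ∈ V := by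
    intro i hi
    have h := V.smul_mem (-2⁻¹ : ℝ) (hV.mem_of_hasFDerivAt (B := (-2 : ℝ) •
      ⇑((c o).smulRight (u o) + (c i).smulRight (u i))) (hconst i) (hTV i hi)
      (fun x => hasFDerivAt_const _ x) (fun x => (T i).hasFDerivAt.comp x (hQ' x)) fun x => by
        simp [hsum, hne o i hi.symm, hTo i hi, hT i hi]
        module)
    simpa using h
  -- For a third index i, the dilation of the (0, i) plane scales only one of the two coordinates
  -- that the rotation in the (0, j) plane mixes, so their bracket is the symmetric counterpart of
  -- the rotation.
  have hS : ∀ j, j ≠ o → ⇑((c o).smulRight (u j) + (c j).smulRight (u o)) ∈ V := by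
    intro j hj
    obtain ⟨i, hi, hij⟩ := hthird o j
    refine hV.mem_of_hasFDerivAt (hP i hi) (hJ j hj) (hlin _) (hlin _) fun x => ?_
    simp [hself, hne o j hj.symm, hne j o hj, hne o i hi.symm, hne i o hi, hne i j hij,
      hne j i hij.symm]
  have hoj : ∀ j, j ≠ o → monomialField c u 1 o j ∈ V := by
    intro j hj
    have h := V.smul_mem (2⁻¹ : ℝ) (V.add_mem (hS j hj) (hJ j hj))
    convert h using 1
    ext x
    simp [monomialField]
    module
  have hjo : ∀ j, j ≠ o → monomialField c u 1 j o ∈ V := by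
    intro j hj
    have h := V.smul_mem (2⁻¹ : ℝ) (V.sub_mem (hS j hj) (hJ j hj))
    convert h using 1
    ext x
    simp [monomialField]
    module
  have h1 : ∀ α β, α ≠ β → monomialField c u 1 β α ∈ V := by
    intro α β h
    by_cases hβ : β = o
    · subst hβ
      exact hoj α h
    by_cases hα : α = o
    · subst hα
      exact hjo β hβ
    refine hV.mem_of_hasFDerivAt (hjo β hβ) (hoj α hα)
      (hasFDerivAt_monomialField c u _ _ _) (hasFDerivAt_monomialField c u _ _ _) fun x => ?_
    simp [monomialField, hself, hne β α h.symm]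
  have h2o : ∀ j, j ≠ o → monomialField c u 2 j o ∈ V := by
    intro j hj
    -- Since DQ(u_0) = 2x, half of [x_j ∂_0, Q] is x_j Im(x). Its derivative along u_0 is zero, so a
    -- second bracket with x_j ∂_0 leaves -x_j² ∂_0.
    have hR : (fun x => c j x • (x - c o x • u o)) ∈ V := by
      have h := V.smul_mem (2⁻¹ : ℝ) (hV.mem_of_hasFDerivAt (B := (2 : ℝ) •
        fun x => c j x • (x - c o x • u o)) (hjo j hj) hQV
        (hasFDerivAt_monomialField c u _ _ _) hQ' fun x => by
          simp [monomialField, hsum, hself, hQ, hne j o hj, smul_smul]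
          module)
      simpa using h
    have hR' : ∀ x, HasFDerivAt (fun x => c j x • (x - c o x • u o))
        (c j x • (ContinuousLinearMap.id ℝ E - (c o).smulRight (u o)) +
          (c j).smulRight (x - c o x • u o)) x := fun x =>
      (c j).hasFDerivAt.smul ((hasFDerivAt_id x).sub (((c o).hasFDerivAt).smul_const (u o)))
    have h := V.neg_mem (hV.mem_of_hasFDerivAt (B := -monomialField c u 2 j o) (hjo j hj) hR
      (hasFDerivAt_monomialField c u _ _ _) hR' fun x => by
        simp [monomialField, hself, hne j o hj]
        module)
    simpa using h
  have h2 : ∀ α β, α ≠ β → monomialField c u 2 β α ∈ V := by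
    have h2' : ∀ α β, α ≠ β → β ≠ o → monomialField c u 2 β α ∈ V := by
      intro α β h hβ
      by_cases hα : α = o
      · subst hα
        exact h2o β hβ
      refine hV.mem_of_hasFDerivAt (h2o β hβ) (hoj α hα)
        (hasFDerivAt_monomialField c u _ _ _) (hasFDerivAt_monomialField c u _ _ _) fun x => ?_
      simp [monomialField, hself, hne β α h.symm]
    intro α β h
    by_cases hβ : β = o
    · subst hβ
      obtain ⟨j, hj, hjα⟩ := hthird β α
      -- Bracketing x_j² ∂_α twice with x_0 ∂_j replaces both factors x_j by x_0.
      have h3 := V.smul_mem (2⁻¹ : ℝ) (hV.mem_of_hasFDerivAt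
        (B := (2 : ℝ) • mixedMonomialField c u 1 β j α) (hoj j hj) (h2' α j hjα.symm hj)
        (hasFDerivAt_monomialField c u _ _ _) (hasFDerivAt_monomialField c u _ _ _) fun x => by
          simp [monomialField, mixedMonomialField, hself, hne β α h.symm, smul_smul]
          congr 1
          ring)
      rw [smul_smul, inv_mul_cancel₀ two_ne_zero, one_smul] at h3
      refine hV.mem_of_hasFDerivAt (hoj j hj) h3
        (hasFDerivAt_monomialField c u _ _ _) (hasFDerivAt_mixedMonomialField c u _ _ _ _)
        fun x => ?_
      simp [monomialField, mixedMonomialField, hself, hne β α h.symm, hne β j hj.symm, smul_smul]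
      ring_nf
    · exact h2' α β h hβ
  exact monomialField_mem_of_one_of_two hV hself hne hthird
    (fun α β => by convert hconst α using 1; ext x; simp [monomialField]) h1 h2 k α β hαβ

end PolynomialFields

/-! ### Generic coefficients and the quadratic equations. -/

section QuadraticFields

/-- A finite-dimensional space is spanned by the points of some continuous curve. -/
theorem exists_continuous_span_range_eq_top (M : Type*) [NormedAddCommGroup M] [NormedSpace ℝ M]
    [FiniteDimensional ℝ M] :
    ∃ γ : ℝ → M, Continuous γ ∧ Submodule.span ℝ (Set.range γ) = ⊤ := by
  let b := Module.finBasis ℝ M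
  -- Tent functions centred at the integers: at time j only the j-th is nonzero, with value 1, so
  -- the curve passes through every basis vector.
  refine ⟨fun t => ∑ i : Fin (Module.finrank ℝ M), max 0 (1 - |t - (i : ℕ)|) • b i, by fun_prop, ?_⟩
  rw [eq_top_iff, ← b.span_eq, Submodule.span_le]
  rintro _ ⟨j, rfl⟩
  refine Submodule.subset_span ⟨(j : ℕ), ?_⟩
  change ∑ i : Fin (Module.finrank ℝ M), max 0 (1 - |((j : ℕ) : ℝ) - (i : ℕ)|) • b i = b j
  rw [Finset.sum_eq_single j _ (by simp)]
  · simp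
  · intro i _ hij
    have h1 : (1 : ℤ) ≤ |((j : ℕ) : ℤ) - (i : ℕ)| :=
      Int.one_le_abs (sub_ne_zero.mpr fun h => hij (Fin.ext (by exact_mod_cast h.symm)))
    have h2 : (1 : ℝ) ≤ |((j : ℕ) : ℝ) - (i : ℕ)| := by exact_mod_cast h1
    rw [max_eq_left (by linarith), zero_smul]

variable {A : Type*} [NormedAddCommGroup A] [NormedSpace ℝ A]

/-- The fields depend linearly on their coefficients, so a curve spanning the coefficient space
gives fields spanning the family. -/
theorem exists_isGenericCoefficients [FiniteDimensional ℝ A] {F : A → A → A → A → A → A}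
    (Λ : A × A × A × A →ₗ[ℝ] (A → A)) (hΛ : ∀ w, Λ w = F w.1 w.2.1 w.2.2.1 w.2.2.2) :
    ∃ bm bL bR e : ℝ → A, Continuous bm ∧ Continuous bL ∧ Continuous bR ∧ Continuous e ∧
      IsGenericCoefficients F bm bL bR e := by
  obtain ⟨γ, hγ, hspan⟩ := exists_continuous_span_range_eq_top (A × A × A × A)
  refine ⟨fun t => (γ t).1, fun t => (γ t).2.1, fun t => (γ t).2.2.1, fun t => (γ t).2.2.2,
    by fun_prop, by fun_prop, by fun_prop, by fun_prop, fun a b c d => ?_⟩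
  have h := Submodule.mem_map_of_mem (f := Λ) (hspan ▸ Submodule.mem_top :
    (a, b, c, d) ∈ Submodule.span ℝ (Set.range γ))
  rw [Submodule.map_span, ← Set.range_comp] at h
  simpa [hΛ, Function.comp_def] using h

variable [Mul A]

/-- The family of quadratic fields as a linear map of its coefficients. -/
theorem exists_linearMap_eq_quadraticField {μ : A →L[ℝ] A →L[ℝ] A} (hμ : ∀ x y, μ x y = x * y)
    {F : A → A → A → A → A → A} (hF : F = leftQuadraticField ∨ F = rightQuadraticField) :
    ∃ Λ : A × A × A × A →ₗ[ℝ] (A → A), ∀ w, Λ w = F w.1 w.2.1 w.2.2.1 w.2.2.2 := by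
  rcases hF with rfl | rfl
  · exact ⟨{ toFun := fun w o => w.1 + μ w.2.1 o + μ o w.2.2.1 + μ w.2.2.2 (μ o o)
             map_add' := fun v w => by ext1 o; simp; abel
             map_smul' := fun r w => by ext1 o; simp },
      fun w => by ext1 o; simp [leftQuadraticField, hμ]⟩
  · exact ⟨{ toFun := fun w o => w.1 + μ w.2.1 o + μ o w.2.2.1 + μ (μ o o) w.2.2.2
             map_add' := fun v w => by ext1 o; simp; abel
             map_smul' := fun r w => by ext1 o; simp },
      fun w => by ext1 o; simp [rightQuadraticField, hμ]⟩

/-- The coefficients are merely continuous in time; smoothness jointly in coefficients and point is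
what local existence of solutions uses. -/
theorem contDiff_quadraticField {μ : A →L[ℝ] A →L[ℝ] A} (hμ : ∀ x y, μ x y = x * y)
    {F : A → A → A → A → A → A} (hF : F = leftQuadraticField ∨ F = rightQuadraticField) :
    ContDiff ℝ ∞ fun z : (A × A × A × A) × A => F z.1.1 z.1.2.1 z.1.2.2.1 z.1.2.2.2 z.2 := by
  rcases hF with rfl | rfl
  · simp only [leftQuadraticField, ← hμ]
    fun_prop
  · simp only [rightQuadraticField, ← hμ]
    fun_prop

/-- The systems with generic quadratic right-hand side, on an algebra with units `u` that square to
`-1`, where `x² = 2 Re(x) x - |x|²`. -/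
theorem generic_quadraticField [FiniteDimensional ℝ A] {ι : Type*} [Fintype ι]
    {μ : A →L[ℝ] A →L[ℝ] A} (hμ : ∀ x y, μ x y = x * y) {c : ι → A →L[ℝ] ℝ} {u : ι → A} {o : ι}
    (hself : ∀ i, c i (u i) = 1) (hne : ∀ i j, i ≠ j → c i (u j) = 0)
    (hthird : ∀ i j : ι, ∃ k, k ≠ i ∧ k ≠ j)
    (hone_mul : ∀ x, u o * x = x) (hmul_one : ∀ x, x * u o = x)
    (hneg : ∀ i, i ≠ o → u i * u i = -u o)
    (hsq : ∀ x, x * x = (2 * c o x) • x - (∑ i, c i x ^ 2) • u o)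
    {F : A → A → A → A → A → A} (hF : F = leftQuadraticField ∨ F = rightQuadraticField) :
    (∃ bm bL bR e : ℝ → A,
      Continuous bm ∧ Continuous bL ∧ Continuous bR ∧ Continuous e ∧
      IsGenericCoefficients F bm bL bR e) ∧
    ∀ bm bL bR e : ℝ → A,
      Continuous bm → Continuous bL → Continuous bR → Continuous e →
      IsGenericCoefficients F bm bL bR e →
      ¬ IsLieSystem (fun t => F (bm t) (bL t) (bR t) (e t)) ∧
      (∀ (α β : ι) (k : ℕ), α ≠ β → (fun x : A => (c β x) ^ k • u α) ∈
        minimalLieAlgebra (fun t => F (bm t) (bL t) (bR t) (e t))) ∧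
      ¬ FiniteDimensional ℝ (minimalLieAlgebra (fun t => F (bm t) (bL t) (bR t) (e t))) := by
  obtain ⟨Λ, hΛ⟩ := exists_linearMap_eq_quadraticField hμ hF
  refine ⟨exists_isGenericCoefficients Λ hΛ, fun bm bL bR e hbm hbL hbR he hgen => ?_⟩
  set X : ℝ → A → A := fun t => F (bm t) (bL t) (bR t) (e t) with hXdef
  have hG := contDiff_quadraticField hμ hF
  have hX : ∀ t, ContDiff ℝ ∞ (X t) := fun t =>
    hG.comp (by fun_prop : ContDiff ℝ ∞ fun x : A => ((bm t, bL t, bR t, e t), x))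
  have hex : ∀ t₀ x₀, ∃ α : ℝ → A, α t₀ = x₀ ∧ IsIntegralCurveAt α X t₀ := fun t₀ x₀ =>
    have : CompleteSpace A := FiniteDimensional.complete ℝ A
    exists_isIntegralCurveAt_comp (hG.of_le (by norm_cast))
      (γ := fun t => (bm t, bL t, bR t, e t)) (by fun_prop) t₀ x₀
  have hzero_mul : ∀ x : A, 0 * x = 0 := fun x => by simp [← hμ]
  have hmul_zero : ∀ x : A, x * 0 = 0 := fun x => by simp [← hμ]
  have hconst : ∀ a, F a 0 0 0 = fun _ => a := by
    rcases hF with rfl | rfl <;> intro a <;> ext1 x <;>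
      simp [leftQuadraticField, rightQuadraticField, hzero_mul, hmul_zero]
  -- `T d` is left or right multiplication by `d`, according to the equation; the listed properties
  -- are common to both.
  obtain ⟨T, hT⟩ : ∃ T : A → A →L[ℝ] A, (∀ d, F 0 0 0 d = fun x => T d (x * x)) ∧
      (∀ x, T (u o) x = x) ∧ ∀ i, i ≠ o → T (u i) (u o) = u i ∧ T (u i) (u i) = -u o := by
    rcases hF with rfl | rfl
    · refine ⟨μ, fun d => ?_, fun x => by rw [hμ, hone_mul], fun i hi =>
        ⟨by rw [hμ, hmul_one], by rw [hμ, hneg i hi]⟩⟩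
      ext1 x
      simp [leftQuadraticField, hzero_mul, hmul_zero, hμ]
    · refine ⟨μ.flip, fun d => ?_, fun x => ?_, fun i hi => ⟨?_, ?_⟩⟩
      · ext1 x
        simp [rightQuadraticField, hzero_mul, hmul_zero, hμ]
      · rw [ContinuousLinearMap.flip_apply, hμ, hmul_one]
      · rw [ContinuousLinearMap.flip_apply, hμ, hone_mul]
      · rw [ContinuousLinearMap.flip_apply, hμ, hneg i hi]
  have hmon : ∀ (α β : ι) (k : ℕ), α ≠ β →
      (fun x : A => (c β x) ^ k • u α) ∈ minimalLieAlgebra X := by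
    intro α β k hαβ
    refine Submodule.mem_sInf.mpr ?_
    rintro V ⟨hV, hXV⟩
    -- Genericity enters here: any Lie algebra containing the `X t` contains the whole family.
    have hFV : ∀ a b c d, F a b c d ∈ V := fun a b c d =>
      Submodule.span_le.mpr (Set.range_subset_iff.mpr hXV) (hgen a b c d)
    refine monomialField_mem hV hself hne hthird (Q := fun x => x * x) hsq (fun a => ?_) ?_
      (fun i => T (u i)) (fun i hi => (hT.2.2 i hi).1) (fun i hi => (hT.2.2 i hi).2)
      (fun i _ => ?_) k hαβ
    · exact hconst (u a) ▸ hFV (u a) 0 0 0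
    · have h := hFV 0 0 0 (u o)
      rw [hT.1] at h
      simpa only [hT.2.1] using h
    · exact hT.1 (u i) ▸ hFV 0 0 0 (u i)
  obtain ⟨α, hα, -⟩ := hthird o o
  have hpoly : ∀ p : Polynomial ℝ,
      (fun x => p.eval ((c o : A →ₗ[ℝ] ℝ) x) • u α) ∈ minimalLieAlgebra X := by
    intro p
    induction p using Polynomial.induction_on' with
    | add p q hp hq =>
      convert Submodule.add_mem _ hp hq using 1
      ext1 x
      simp [add_smul]
    | monomial k a =>
      convert Submodule.smul_mem _ a (hmon α o k hα) using 1
      ext1 x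
      simp [mul_smul]
  have hc : (c o : A →ₗ[ℝ] ℝ) ≠ 0 := fun h => by simpa [hself] using LinearMap.congr_fun h (u o)
  have hu : u α ≠ 0 := fun h => by simpa [h] using hself α
  exact ⟨not_isLieSystem_of_polynomial_mem hX hex hc hu hpoly, hmon,
    not_finiteDimensional_of_polynomial_mem hc hu hpoly⟩

end QuadraticFields

/-! ### Units, coordinates and squares of quaternions and octonions. -/

@[simp] theorem quaternionUnit_re (α : Fin 4) :
    (quaternionUnit α).re = if α = 0 then 1 else 0 := rfl

@[simp] theorem quaternionUnit_imI (α : Fin 4) :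
    (quaternionUnit α).imI = if α = 1 then 1 else 0 := rfl

@[simp] theorem quaternionUnit_imJ (α : Fin 4) :
    (quaternionUnit α).imJ = if α = 2 then 1 else 0 := rfl

@[simp] theorem quaternionUnit_imK (α : Fin 4) :
    (quaternionUnit α).imK = if α = 3 then 1 else 0 := rfl

theorem quaternionUnit_zero : quaternionUnit 0 = 1 := by
  ext <;> simp

theorem quaternionCoord_unit_self (i : Fin 4) : quaternionCoord i (quaternionUnit i) = 1 := by
  fin_cases i <;> simp [quaternionCoord]

theorem quaternionCoord_unit_of_ne {i j : Fin 4} (h : i ≠ j) :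
    quaternionCoord i (quaternionUnit j) = 0 := by
  fin_cases j <;> fin_cases i <;> first | exact absurd rfl h | simp [quaternionCoord]

theorem quaternion_mul_self_eq (q : ℍ[ℝ]) :
    q * q = (2 * quaternionCoord 0 q) • q -
      (∑ i, quaternionCoord i q ^ 2) • quaternionUnit 0 := by
  ext <;> simp [quaternionUnit_zero, quaternionCoord, Fin.sum_univ_four] <;> ring

theorem quaternionUnit_mul_self {i : Fin 4} (hi : i ≠ 0) :
    quaternionUnit i * quaternionUnit i = -quaternionUnit 0 := by
  rw [quaternion_mul_self_eq, quaternionCoord_unit_of_ne hi.symm, Finset.sum_eq_single i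
    (fun j _ hj => by rw [quaternionCoord_unit_of_ne hj, zero_pow two_ne_zero]) (by simp),
    quaternionCoord_unit_self]
  simp

/-- The coordinates of a quaternion as continuous linear forms. -/
noncomputable def quaternionCoordL (β : Fin 4) : ℍ[ℝ] →L[ℝ] ℝ :=
  LinearMap.toContinuousLinearMap
    { toFun := quaternionCoord β
      map_add' := fun x y => by fin_cases β <;> simp [quaternionCoord]
      map_smul' := fun r x => by fin_cases β <;> simp [quaternionCoord] }

namespace Octonion

theorem ext_fst_snd {x y : Octonion} (h₁ : x.fst = y.fst) (h₂ : x.snd = y.snd) : x = y :=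
  WithLp.ofLp_injective 2 (Prod.ext h₁ h₂)

@[simp] theorem mk_fst (a b : ℍ[ℝ]) : (mk a b).fst = a := rfl

@[simp] theorem mk_snd (a b : ℍ[ℝ]) : (mk a b).snd = b := rfl

@[simp] theorem mul_fst (x y : Octonion) :
    (x * y).fst = x.fst * y.fst - star y.snd * x.snd := rfl

@[simp] theorem mul_snd (x y : Octonion) :
    (x * y).snd = y.snd * x.fst + x.snd * star y.fst := rfl

theorem unit_zero : unit 0 = mk 1 0 := by
  rw [← quaternionUnit_zero]
  rfl

theorem unit_zero_mul (x : Octonion) : unit 0 * x = x := by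
  rw [unit_zero]
  exact ext_fst_snd (by simp) (by simp)

theorem mul_unit_zero (x : Octonion) : x * unit 0 = x := by
  rw [unit_zero]
  exact ext_fst_snd (by simp) (by simp)

/-- The quadratic equation x² - 2 Re(x) x + |x|² = 0, the only source of the nonlinear terms in the
bracket computations. -/
theorem mul_self_eq (x : Octonion) :
    x * x = (2 * coord 0 x) • x - (∑ i, coord i x ^ 2) • unit 0 := by
  rw [unit_zero]
  refine ext_fst_snd ?_ ?_ <;> ext <;> simp [coord, Fin.sum_univ_eight] <;> ring

/-- The coordinates of an octonion as continuous linear forms. -/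
noncomputable def coordL (β : Fin 8) : Octonion →L[ℝ] ℝ :=
  LinearMap.toContinuousLinearMap
    { toFun := coord β
      map_add' := fun x y => by fin_cases β <;> simp [coord]
      map_smul' := fun r x => by fin_cases β <;> simp [coord] }

theorem coord_unit_self (i : Fin 8) : coord i (unit i) = 1 := by
  fin_cases i <;> simp [coord, unit]

theorem coord_unit_of_ne {i j : Fin 8} (h : i ≠ j) : coord i (unit j) = 0 := by
  fin_cases j <;> fin_cases i <;> first | exact absurd rfl h | simp [coord, unit]

theorem unit_mul_self {i : Fin 8} (hi : i ≠ 0) : unit i * unit i = -unit 0 := by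
  rw [mul_self_eq, coord_unit_of_ne hi.symm, Finset.sum_eq_single i
    (fun j _ hj => by rw [coord_unit_of_ne hj, zero_pow two_ne_zero]) (by simp), coord_unit_self]
  simp

/-- The multiplication of octonions as a continuous bilinear map. -/
noncomputable def mulL : Octonion →L[ℝ] Octonion →L[ℝ] Octonion :=
  LinearMap.toContinuousLinearMap (LinearMap.toContinuousLinearMap.toLinearMap ∘ₗ
    LinearMap.mk₂ ℝ (fun x y : Octonion => x * y)
      (fun x y z => ext_fst_snd (by simp [add_mul, mul_add]; abel) (by simp [add_mul, mul_add]; abel))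
      (fun r x y => ext_fst_snd (by simp [smul_sub]) (by simp))
      (fun x y z => ext_fst_snd (by simp [add_mul, mul_add]; abel) (by simp [add_mul, mul_add]; abel))
      (fun r x y => ext_fst_snd (by simp [smul_sub]) (by simp)))

end Octonion

theorem proposition7p2 :
    (∀ F : Octonion → Octonion → Octonion → Octonion → Octonion → Octonion,
      F = leftQuadraticField ∨ F = rightQuadraticField →
      (∃ bm bL bR e : ℝ → Octonion,
        Continuous bm ∧ Continuous bL ∧ Continuous bR ∧ Continuous e ∧
        IsGenericCoefficients F bm bL bR e) ∧
      ∀ bm bL bR e : ℝ → Octonion,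
        Continuous bm → Continuous bL → Continuous bR → Continuous e →
        IsGenericCoefficients F bm bL bR e →
        ¬ IsLieSystem (fun t => F (bm t) (bL t) (bR t) (e t)) ∧
        (∀ (α β : Fin 8) (k : ℕ), α ≠ β →
          (fun o : Octonion => (Octonion.coord β o) ^ k • Octonion.unit α) ∈
            minimalLieAlgebra (fun t => F (bm t) (bL t) (bR t) (e t))) ∧
        ¬ FiniteDimensional ℝ (minimalLieAlgebra (fun t => F (bm t) (bL t) (bR t) (e t)))) ∧
    (∀ F : ℍ[ℝ] → ℍ[ℝ] → ℍ[ℝ] → ℍ[ℝ] → ℍ[ℝ] → ℍ[ℝ],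
      F = leftQuadraticField ∨ F = rightQuadraticField →
      (∃ bm bL bR e : ℝ → ℍ[ℝ],
        Continuous bm ∧ Continuous bL ∧ Continuous bR ∧ Continuous e ∧
        IsGenericCoefficients F bm bL bR e) ∧
      ∀ bm bL bR e : ℝ → ℍ[ℝ],
        Continuous bm → Continuous bL → Continuous bR → Continuous e →
        IsGenericCoefficients F bm bL bR e →
        ¬ IsLieSystem (fun t => F (bm t) (bL t) (bR t) (e t)) ∧
        (∀ (α β : Fin 4) (k : ℕ), α ≠ β →
          (fun q : ℍ[ℝ] => (quaternionCoord β q) ^ k • quaternionUnit α) ∈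
            minimalLieAlgebra (fun t => F (bm t) (bL t) (bR t) (e t))) ∧
        ¬ FiniteDimensional ℝ
          (minimalLieAlgebra (fun t => F (bm t) (bL t) (bR t) (e t)))) := by
  refine ⟨fun F hF => ?_, fun F hF => ?_⟩
  · exact generic_quadraticField (μ := Octonion.mulL) (fun _ _ => rfl) (c := Octonion.coordL)
      (u := Octonion.unit) (o := 0) Octonion.coord_unit_self
      (fun _ _ h => Octonion.coord_unit_of_ne h) (by decide) Octonion.unit_zero_mul
      Octonion.mul_unit_zero (fun _ h => Octonion.unit_mul_self h) Octonion.mul_self_eq hF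
  · exact generic_quadraticField (μ := ContinuousLinearMap.mul ℝ ℍ[ℝ]) (fun _ _ => rfl)
      (c := quaternionCoordL) (u := quaternionUnit) (o := 0)
      quaternionCoord_unit_self (fun _ _ h => quaternionCoord_unit_of_ne h)
      (by decide) (fun x => by rw [quaternionUnit_zero, one_mul])
      (fun x => by rw [quaternionUnit_zero, mul_one]) (fun _ h => quaternionUnit_mul_self h)
      quaternion_mul_self_eq hF
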